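/- For elements $x,y,z$ of a group write $[x,y]=x^{-1}y^{-1}xy$ and $[x,y,z]=[[x,y],z]$; let $G_1=G$, $G_{n+1}=[G_n,G]$ be the lower central series of a group $G$, and $Z(G)$ its center. The $3$-nilpotent product of groups $C_1,\ldots,C_r$ is $F/F_4$, where $F=C_1*\cdots*C_r$ is their free product. \textbf{Theorem.} Let $r\ge 2$ and let $C_1,\ldots,C_r$ be cyclic groups generated by $x_1,\ldots,x_r$ respectively; assume that $x_i$ has order $2^{\alpha_i}$, where $1\le\alpha_1\le\alpha_2\le\cdots\le\alpha_r$. Let $G$ be the $3$-nilpotent product of the $C_i$, and denote the image of $x_i$ in $G$ again by $x_i$. Then: (a) An element $g\in G$ lies in $Z(G)$ if and only if it can be written as $$g=x_r^{c_r}\prod_{1\le i<j\le r}[x_j,x_i]^{c_{ji}}\,[x_j,x_i^2]^{c_{jii}}\,[x_j^2,x_i]^{c_{jij}}\prod_{1\le i<j<k\le r}[x_j,x_i,x_k]^{c_{jik}}\,[x_k,x_i,x_j]^{c_{kij}}$$ with integer exponents in the ranges $0\le c_r<2^{\alpha_r}$, $0\le c_{ji}<2^{\alpha_i+1}$, $0\le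 c_{jii}<2^{\alpha_i-1}$, $0\le c_{jij}<2^{\alpha_i-1}$ if $\alpha_i=\alpha_j$ and $0\le c_{jij}<2^{\alpha_i}$ if $\alpha_i<\alpha_j$, $0\le c_{jik},c_{kij}<2^{\alpha_i}$, such that $$c_r\equiv 0 \pmod{2^{\alpha_{r-1}+1}}\qquad\text{and}\qquad c_{ji}+2c_{jii}+2c_{jij}\equiv 0\pmod{2^{\alpha_i}}\quad\text{for all }1\le i<j\le r.$$ (b) $Z(G)$ is generated by $x_r^{2^{\alpha_{r-1}+1}}$; the elements $[x_j,x_i]^{2^{\alpha_i+1}-2}[x_j,x_i^2]$, $[x_j,x_i]^{2^{\alpha_i+1}-2}[x_j^2,x_i]$ and $[x_j,x_i]^{2^{\alpha_i}}$ for $1\le i<j\le r$; and the elements $[x_j,x_i,x_k]$ and $[x_k,x_i,x_j]$ for $1\le i<j<k\le r$. (c) In other words, $$Z(G)=\Bigl\langle \{x_r^{2^{\alpha_{r-1}+1}}\}\cup G_3\cup\{[x_j,x_i]^{2^{\alpha_i}} \mid 1\le i<j\le r\}\Bigr\rangle.$$ -/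

import Mathlib

/-- The `k`-nilpotent product of the groups `A i`: the free product `F` of the `A i` modulo the
`(k+1)`-st term `F_{k+1}` of its lower central series. Mathlib numbers the lower central series
from `0`, so `F_{k+1}` is the term with index `k`. -/
abbrev NilpotentProduct (k : ℕ) {ι : Type*} (A : ι → Type*) [∀ i, Group (A i)] : Type _ :=
  Monoid.CoprodI A ⧸ (⊤ : Subgroup (Monoid.CoprodI A)).lowerCentralSeries k

namespace NilpotentProduct

/-- The canonical homomorphism from a factor to the `k`-nilpotent product. -/
def inc (k : ℕ) {ι : Type*} (A : ι → Type*) [∀ i, Group (A i)] (i : ι) :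
    A i →* NilpotentProduct k A :=
  (QuotientGroup.mk' ((⊤ : Subgroup (Monoid.CoprodI A)).lowerCentralSeries k)).comp
    Monoid.CoprodI.of

/-- The commutator `[x, y] = x⁻¹ y⁻¹ x y` (Mathlib's `⁅x, y⁆` is `x y x⁻¹ y⁻¹`). -/
def comm {G : Type*} [Group G] (x y : G) : G := x⁻¹ * y⁻¹ * x * y

/-- The pairs `(i, j)` with `i < j`, in lexicographic order. -/
def pairs (r : ℕ) : List (Fin r × Fin r) :=
  (List.finRange r ×ˢ List.finRange r).filter (fun p => p.1 < p.2)

/-- The triples `(i, j, k)` with `i < j < k`, in lexicographic order. -/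
def triples (r : ℕ) : List (Fin r × Fin r × Fin r) :=
  (List.finRange r ×ˢ List.finRange r ×ˢ List.finRange r).filter
    (fun p => p.1 < p.2.1 ∧ p.2.1 < p.2.2)

/-- Exponents of a normal form in a `3`-nilpotent product of `r` cyclic `2`-groups. Only the
entries with `i < j`, respectively `i < j < k`, are used. -/
structure Exponents (r : ℕ) where
  /-- `gen i` is the exponent of `x_i`. -/
  gen : Fin r → ℕ
  /-- `ji i j` is the exponent of `[x_j, x_i]`. -/
  ji : Fin r → Fin r → ℕ
  /-- `jii i j` is the exponent of `[x_j, x_i ^ 2]`. -/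
  jii : Fin r → Fin r → ℕ
  /-- `jij i j` is the exponent of `[x_j ^ 2, x_i]`. -/
  jij : Fin r → Fin r → ℕ
  /-- `jik i j k` is the exponent of `[[x_j, x_i], x_k]`. -/
  jik : Fin r → Fin r → Fin r → ℕ
  /-- `kij i j k` is the exponent of `[[x_k, x_i], x_j]`. -/
  kij : Fin r → Fin r → Fin r → ℕ

namespace Exponents

/-- The exponents lie in the ranges of the normal form, where `x_i` has order `2 ^ α i`. -/
def InRange {r : ℕ} (α : Fin r → ℕ) (c : Exponents r) : Prop :=
  (∀ i, c.gen i < 2 ^ α i) ∧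
  (∀ i j, i < j →
    c.ji i j < 2 ^ (α i + 1) ∧
    c.jii i j < 2 ^ (α i - 1) ∧
    c.jij i j < (if α i = α j then 2 ^ (α i - 1) else 2 ^ α i)) ∧
  (∀ i j k, i < j → j < k → c.jik i j k < 2 ^ α i ∧ c.kij i j k < 2 ^ α i)

/-- The quantity `α(c_{ji}) = c_{ji} + 2 c_{jii} + 2 c_{jij}`. -/
def alpha {r : ℕ} (c : Exponents r) (i j : Fin r) : ℕ :=
  c.ji i j + 2 * c.jii i j + 2 * c.jij i j

/-- The element
`x_1 ^ c_1 ⋯ x_r ^ c_r ∏_{i<j} [x_j, x_i] ^ c_{ji} [x_j, x_i ^ 2] ^ c_{jii} [x_j ^ 2, x_i] ^ c_{jij}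
∏_{i<j<k} [x_j, x_i, x_k] ^ c_{jik} [x_k, x_i, x_j] ^ c_{kij}`.
In a group of nilpotency class at most `3` all the commutators that occur commute with each other,
so the order of the factors in the last two products is immaterial. -/
def eval {r : ℕ} {G : Type*} [Group G] (x : Fin r → G) (c : Exponents r) : G :=
  ((List.finRange r).map fun i => x i ^ c.gen i).prod *
  ((pairs r).map fun (i, j) =>
    comm (x j) (x i) ^ c.ji i j * comm (x j) (x i ^ 2) ^ c.jii i j *
      comm (x j ^ 2) (x i) ^ c.jij i j).prod *
  ((triples r).map fun (i, j, k) =>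
    comm (comm (x j) (x i)) (x k) ^ c.jik i j k *
      comm (comm (x k) (x i)) (x j) ^ c.kij i j k).prod

end Exponents

end NilpotentProduct

/-! In class three, `G_2` is abelian and `G_3` is central, so commutators of powers expand
explicitly with binomial coefficients, and weight-three commutators are multiplicative in each
entry. Hence every element has a normal form with exponents in the stated ranges (`exists_eval`).
Uniqueness of that form is never needed.

The listed generators are central: `[x_j, x_i]^{2^{α_i}}` lies in `G_3` because `x_i^{2^{α_i}} = 1`,
and `x_r` raised to `2^{α_{r-1}+1}` commutes with each `x_i` by the expansion formula
(`pow_last_mem_center`).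

Conversely, let a normal form be central and fix `i < j`. A homomorphism to affine maps `z ↦ t z +
v` over a quotient of `ℤ[X]/(X^3)`, with `N` the image of `X`, kills every generator except `x_i ↦ τ
z + 1` and `x_j ↦ (1 + N) z`. Linear parts are `1` modulo `N` and `N^3 = 0`, so the image has class
at most three and the map factors through `G`. The ring and `τ` are chosen so that both images have
admissible orders while `N` and `N^2` still detect divisibility by `2^{α_i}`. Commuting with the two
images then yields the congruences (`Aff.commute_analysis`, `exponents_of_mem_center`). -/

namespace NilpotentProduct

/-! ### Commutator calculus in nilpotency class three. -/

section Calculus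

variable {G : Type*} [Group G]

theorem comm_mem_lowerCentralSeries {n : ℕ} {a : G}
    (ha : a ∈ (⊤ : Subgroup G).lowerCentralSeries n) (b : G) :
    comm a b ∈ (⊤ : Subgroup G).lowerCentralSeries (n + 1) := by
  have h := Subgroup.commutator_mem_commutator (inv_mem ha) (Subgroup.mem_top b⁻¹)
  simpa [comm, commutatorElement_def] using h

theorem comm_mem_one (a b : G) : comm a b ∈ (⊤ : Subgroup G).lowerCentralSeries 1 :=
  comm_mem_lowerCentralSeries (n := 0) (Subgroup.mem_top a) b

theorem comm_eq_one_iff {a b : G} : comm a b = 1 ↔ a * b = b * a := by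
  rw [comm, mul_assoc, ← mul_inv_rev, inv_mul_eq_one, eq_comm]

theorem comm_inv (a b : G) : (comm a b)⁻¹ = comm b a := by
  simp [comm, mul_assoc]

theorem map_comm {H : Type*} [Group H] (f : G →* H) (a b : G) :
    f (comm a b) = comm (f a) (f b) := by
  simp [comm]

theorem comm_one_left (b : G) : comm 1 b = 1 := by simp [comm]

theorem comm_one_right (b : G) : comm b 1 = 1 := by simp [comm]

variable (hG : (⊤ : Subgroup G).lowerCentralSeries 3 = ⊥)
include hG

theorem commute_of_mem_two {z : G} (hz : z ∈ (⊤ : Subgroup G).lowerCentralSeries 2) (g : G) :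
    z * g = g * z := by
  have := comm_mem_lowerCentralSeries hz g
  rw [hG, Subgroup.mem_bot] at this
  exact comm_eq_one_iff.1 this

theorem lowerCentralSeries_two_le_center :
    (⊤ : Subgroup G).lowerCentralSeries 2 ≤ Subgroup.center G := fun _ hz =>
  Subgroup.mem_center_iff.2 fun g => (commute_of_mem_two hG hz g).symm

/-- `[d, gh] = [d, h] [d, g]^h`, and for `d` in `G_2` both factors are central. -/
theorem comm_mul_right {d : G} (hd : d ∈ (⊤ : Subgroup G).lowerCentralSeries 1) (g h : G) :
    comm d (g * h) = comm d g * comm d h := by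
  have key : comm d (g * h) = comm d h * (h⁻¹ * (comm d g * h)) := by
    simp only [comm]; group
  rw [key, commute_of_mem_two hG (comm_mem_lowerCentralSeries hd g), inv_mul_cancel_left,
    commute_of_mem_two hG (comm_mem_lowerCentralSeries hd h)]

theorem comm_mul_left {d e : G} (hd : d ∈ (⊤ : Subgroup G).lowerCentralSeries 1) (g : G) :
    comm (d * e) g = comm d g * comm e g := by
  have key : comm (d * e) g = e⁻¹ * (comm d g * e) * comm e g := by
    simp only [comm]; group
  rw [key, commute_of_mem_two hG (comm_mem_lowerCentralSeries hd g), inv_mul_cancel_left]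

theorem comm_pow_right_of_mem {d : G} (hd : d ∈ (⊤ : Subgroup G).lowerCentralSeries 1) (g : G)
    (n : ℕ) : comm d (g ^ n) = comm d g ^ n := by
  induction n with
  | zero => simp [comm]
  | succ n ih => rw [pow_succ, pow_succ, comm_mul_right hG hd, ih]

theorem comm_pow_left_of_mem {d : G} (hd : d ∈ (⊤ : Subgroup G).lowerCentralSeries 1) (g : G)
    (n : ℕ) : comm (d ^ n) g = comm d g ^ n := by
  induction n with
  | zero => simp [comm]
  | succ n ih => rw [pow_succ, pow_succ, comm_mul_left hG (pow_mem hd n), ih]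

theorem comm_inv_right_of_mem {d : G} (hd : d ∈ (⊤ : Subgroup G).lowerCentralSeries 1) (g : G) :
    comm d g⁻¹ = (comm d g)⁻¹ := by
  rw [eq_inv_iff_mul_eq_one, ← comm_mul_right hG hd, inv_mul_cancel, comm_one_right]

theorem comm_inv_left_of_mem {d : G} (hd : d ∈ (⊤ : Subgroup G).lowerCentralSeries 1) (g : G) :
    comm d⁻¹ g = (comm d g)⁻¹ := by
  rw [eq_inv_iff_mul_eq_one, ← comm_mul_left hG (inv_mem hd), inv_mul_cancel, comm_one_left]

/-- The second term of the lower central series is abelian in class three. -/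
theorem commute_of_mem_one {d e : G} (hd : d ∈ (⊤ : Subgroup G).lowerCentralSeries 1)
    (he : e ∈ (⊤ : Subgroup G).lowerCentralSeries 1) : Commute d e := by
  have hle : (⊤ : Subgroup G).lowerCentralSeries 1 ≤ Subgroup.centralizer {d} := by
    rw [Subgroup.lowerCentralSeries_succ, Subgroup.commutator_le]
    intro a _ b _
    -- For `d` in `G_2`, `g ↦ [d, g]` is a homomorphism into the centre, so it kills commutators.
    rw [Subgroup.mem_centralizer_singleton_iff, ← comm_eq_one_iff]
    rw [← inv_inj, comm_inv, inv_one, commutatorElement_def, comm_mul_right hG hd,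
      comm_mul_right hG hd, comm_mul_right hG hd, comm_inv_right_of_mem hG hd,
      comm_inv_right_of_mem hG hd,
      commute_of_mem_two hG (comm_mem_lowerCentralSeries hd a)]
    simp
  exact ((Subgroup.mem_centralizer_singleton_iff).1 (hle he)).symm

/-- Passing from `n` to `n + 1` conjugates `[y, x^n]` by `x`, which contributes `[y, x, x]^n`; these
exponents sum to `n.choose 2`. -/
theorem comm_pow_right (y x : G) (n : ℕ) :
    comm y (x ^ n) = comm y x ^ n * comm (comm y x) x ^ n.choose 2 := by
  have hc := comm_mem_one y x
  have hu := comm_mem_lowerCentralSeries hc x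
  induction n with
  | zero => simp [comm]
  | succ n ih =>
    have key : comm y (x ^ n * x) = comm y x * (comm y (x ^ n) * comm (comm y (x ^ n)) x) := by
      simp only [comm]; group
    have h2 : comm (comm y (x ^ n)) x = comm (comm y x) x ^ n := by
      rw [ih, comm_mul_left hG (pow_mem hc _), comm_pow_left_of_mem hG hc,
        comm_eq_one_iff.2 (commute_of_mem_two hG (pow_mem hu _) x), mul_one]
    rw [pow_succ, key, h2, ih, Nat.choose_succ_succ' n 1, Nat.choose_one_right, add_comm n,
      pow_add, pow_succ']
    group

theorem comm_pow_left (y x : G) (n : ℕ) :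
    comm (y ^ n) x = comm y x ^ n * comm (comm y x) y ^ n.choose 2 := by
  have hc := comm_mem_one y x
  have hv := comm_mem_lowerCentralSeries hc y
  induction n with
  | zero => simp [comm]
  | succ n ih =>
    have key : comm (y ^ n * y) x = comm (y ^ n) x * comm (comm (y ^ n) x) y * comm y x := by
      simp only [comm]; group
    have h2 : comm (comm (y ^ n) x) y = comm (comm y x) y ^ n := by
      rw [ih, comm_mul_left hG (pow_mem hc _), comm_pow_left_of_mem hG hc,
        comm_eq_one_iff.2 (commute_of_mem_two hG (pow_mem hv _) y), mul_one]
    rw [pow_succ y, key, h2, ih, Nat.choose_succ_succ' n 1, Nat.choose_one_right,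
      add_comm n (n.choose (1 + 1)), pow_add (comm (comm y x) y), pow_succ (comm y x),
      mul_assoc, mul_assoc, mul_assoc, ← mul_assoc _ _ (comm y x),
      commute_of_mem_two hG (mul_mem (pow_mem hv _) (pow_mem hv _)) (comm y x)]

theorem comm_comm_inv_right (x y z : G) : comm (comm x y⁻¹) z = (comm (comm x y) z)⁻¹ := by
  have hd := comm_mem_one x y
  have key : comm x y⁻¹ = (comm x y)⁻¹ * comm (comm x y)⁻¹ y⁻¹ := by simp only [comm]; group
  rw [key, comm_mul_left hG (inv_mem hd),
    comm_eq_one_iff.2 (commute_of_mem_two hG (comm_mem_lowerCentralSeries (inv_mem hd) _) z),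
    mul_one, comm_inv_left_of_mem hG hd]

/-- The Jacobi identity in class three. -/
theorem comm_jacobi (x y z : G) :
    comm (comm x y) z * comm (comm y z) x * comm (comm z x) y = 1 := by
  -- The Hall–Witt identity, valid in any group; the conjugations disappear by centrality.
  have hw : (y⁻¹ * (comm (comm x y⁻¹) z * y)) * (z⁻¹ * (comm (comm y z⁻¹) x * z)) *
      (x⁻¹ * (comm (comm z x⁻¹) y * x)) = 1 := by
    simp only [comm]; group
  have hm : ∀ a b c g : G, g⁻¹ * (comm (comm a b) c * g) = comm (comm a b) c := fun a b c g => by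
    rw [commute_of_mem_two hG (comm_mem_lowerCentralSeries (comm_mem_one a b) c),
      inv_mul_cancel_left]
  rw [hm, hm, hm, comm_comm_inv_right hG, comm_comm_inv_right hG, comm_comm_inv_right hG,
    ← mul_inv_rev, ← mul_inv_rev, inv_eq_one] at hw
  rw [mul_assoc, commute_of_mem_two hG (comm_mem_lowerCentralSeries (comm_mem_one x y) z),
    commute_of_mem_two hG (comm_mem_lowerCentralSeries (comm_mem_one y z) x), mul_assoc, hw]

end Calculus

/-! ### Relations forced by the orders of the generators. -/

section Orders

variable {G : Type*} [Group G] (hG : (⊤ : Subgroup G).lowerCentralSeries 3 = ⊥)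
  {x y : G} {a b : ℕ}
include hG

theorem comm_sq_right (y x : G) :
    comm y (x ^ 2) = comm y x ^ 2 * comm (comm y x) x := by
  simpa using comm_pow_right hG y x 2

theorem comm_sq_left (y x : G) :
    comm (y ^ 2) x = comm y x ^ 2 * comm (comm y x) y := by
  simpa using comm_pow_left hG y x 2

omit hG in
-- The binomial coefficient is `m` modulo `2m`, not `0`: this is the peculiarity of the prime 2, and
-- the source of the factors of 2 in the theorem.
theorem choose_two_double {m : ℕ} (hm : 1 ≤ m) : (2 * m).choose 2 = (2 * m) * (m - 1) + m := by
  obtain ⟨k, rfl⟩ : ∃ k, m = k + 1 := ⟨m - 1, by omega⟩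
  rw [Nat.choose_two_right]
  apply Nat.div_eq_of_eq_mul_left (by norm_num)
  have : 2 * (k + 1) - 1 = 2 * k + 1 := by omega
  rw [this, Nat.add_sub_cancel]
  ring

theorem comm_comm_right_pow_eq_one {n : ℕ} (y : G) (hx : x ^ n = 1) :
    comm (comm y x) x ^ n = 1 := by
  rw [← comm_pow_right_of_mem hG (comm_mem_one y x), hx, comm_one_right]

theorem comm_pow_mem_two {n : ℕ} (y : G) (hx : x ^ n = 1) :
    comm y x ^ n ∈ (⊤ : Subgroup G).lowerCentralSeries 2 := by
  have h := comm_pow_right hG y x n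
  rw [hx, comm_one_right] at h
  rw [← inv_eq_of_mul_eq_one_left h.symm]
  exact inv_mem (pow_mem (comm_mem_lowerCentralSeries (comm_mem_one y x) x) _)

theorem comm_comm_pow_eq_one_of_right {n : ℕ} (y z : G) (hx : x ^ n = 1) :
    comm (comm y x) z ^ n = 1 := by
  rw [← comm_pow_left_of_mem hG (comm_mem_one y x)]
  exact comm_eq_one_iff.2 (commute_of_mem_two hG (comm_pow_mem_two hG y hx) z)

theorem comm_pow_mul_comm_comm_right {m : ℕ} (hm : 1 ≤ m) (y : G) (hx : x ^ (2 * m) = 1) :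
    comm y x ^ (2 * m) * comm (comm y x) x ^ m = 1 := by
  have h := comm_pow_right hG y x (2 * m)
  rw [hx, comm_one_right, choose_two_double hm, pow_add, pow_mul (comm (comm y x) _),
    comm_comm_right_pow_eq_one hG y hx, one_pow, one_mul] at h
  exact h.symm

theorem comm_pow_mul_comm_comm_left {m : ℕ} (hm : 1 ≤ m) (hx : x ^ (2 * m) = 1)
    (hy : y ^ (2 * m) = 1) : comm y x ^ (2 * m) * comm (comm y x) y ^ m = 1 := by
  have h := comm_pow_left hG y x (2 * m)
  rw [hy, comm_one_left, choose_two_double hm, pow_add, pow_mul (comm (comm y x) _),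
    comm_comm_pow_eq_one_of_right hG y y hx, one_pow, one_mul] at h
  exact h.symm

/-- Expand `[y, x^{2n}] = 1`: the binomial exponent is a multiple of `n`, which kills `[y, x, x]`.
This gives the range `2^{α_i+1}` of `c_{ji}`. -/
theorem comm_pow_double_eq_one {n : ℕ} (y : G) (hx : x ^ n = 1) :
    comm y x ^ (2 * n) = 1 := by
  have h := comm_pow_right hG y x (2 * n)
  rcases Nat.eq_zero_or_pos n with rfl | hn
  · simp
  rw [mul_comm 2 n, pow_mul x, hx, one_pow, comm_one_right, mul_comm n 2, choose_two_double hn,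
    pow_add, mul_assoc 2 n, mul_left_comm 2 n, pow_mul _ n,
    comm_comm_right_pow_eq_one hG y hx, one_pow, mul_one, mul_one] at h
  exact h.symm

theorem comm_sq_right_pow_eq_one {m : ℕ} (hm : 1 ≤ m) (y : G) (hx : x ^ (2 * m) = 1) :
    comm y (x ^ 2) ^ m = 1 := by
  have hc := comm_mem_one y x
  rw [comm_sq_right hG, (commute_of_mem_one hG (pow_mem hc 2)
    (Subgroup.lowerCentralSeries_antitone _ one_le_two
      (comm_mem_lowerCentralSeries hc x))).mul_pow, ← pow_mul,
    comm_pow_mul_comm_comm_right hG hm y hx]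

theorem comm_sq_left_pow {m : ℕ} (y x : G) :
    comm (y ^ 2) x ^ m = comm y x ^ (2 * m) * comm (comm y x) y ^ m := by
  have hc := comm_mem_one y x
  rw [comm_sq_left hG, (commute_of_mem_one hG (pow_mem hc 2)
    (Subgroup.lowerCentralSeries_antitone _ one_le_two
      (comm_mem_lowerCentralSeries hc y))).mul_pow, ← pow_mul]

theorem comm_sq_left_pow_eq_one {n : ℕ} (y : G) (hx : x ^ n = 1) :
    comm (y ^ 2) x ^ n = 1 := by
  rw [comm_sq_left_pow hG, comm_pow_double_eq_one hG y hx,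
    comm_comm_pow_eq_one_of_right hG y y hx, one_mul]

/-- Once `2n ∣ k`, both `k` and `k.choose 2` kill their factors in the expansion of `[y^k, x]`. This
explains the exponent of `x_r` in the centre. -/
theorem comm_pow_left_eq_one {n k : ℕ} (y : G) (hx : x ^ n = 1) (hk : 2 * n ∣ k) :
    comm (y ^ k) x = 1 := by
  obtain ⟨l, rfl⟩ := hk
  rcases Nat.eq_zero_or_pos (n * l) with h0 | hpos
  · rw [mul_assoc, h0, mul_zero, pow_zero, comm_one_left]
  rw [comm_pow_left hG, pow_mul, comm_pow_double_eq_one hG y hx, one_pow, one_mul,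
    mul_assoc, choose_two_double hpos,
    show 2 * (n * l) * (n * l - 1) + n * l = n * (2 * l * (n * l - 1) + l) by ring,
    pow_mul, comm_comm_pow_eq_one_of_right hG y y hx, one_pow]

end Orders

/-! ### Ordered products of powers in a commutative subgroup. -/

section Lists

variable {G ι : Type*} [Group G]

theorem exists_pow_lt_eq_zpow {g : G} {n : ℕ} (hn : 0 < n) (hg : g ^ n = 1) (e : ℤ) :
    ∃ m : ℕ, m < n ∧ g ^ m = g ^ e := by
  have hn' : (0 : ℤ) < n := by exact_mod_cast hn
  refine ⟨(e % n).toNat, ?_, ?_⟩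
  · have := Int.emod_lt_of_pos e hn'
    have := Int.emod_nonneg e hn'.ne'
    omega
  · rw [← zpow_natCast, Int.toNat_of_nonneg (Int.emod_nonneg e hn'.ne')]
    conv_rhs => rw [← Int.emod_add_mul_ediv e n, zpow_add, zpow_mul, zpow_natCast, hg,
      one_zpow, mul_one]

theorem list_prod_mem {A : Subgroup G} {l : List ι} {f : ι → G} (h : ∀ i ∈ l, f i ∈ A) :
    (l.map f).prod ∈ A := by
  apply Subgroup.list_prod_mem
  simpa using h

theorem list_prod_map_mul_of_commute {l : List ι} {f g : ι → G}
    (h : ∀ i ∈ l, ∀ j ∈ l, Commute (g i) (f j)) :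
    (l.map fun i => f i * g i).prod = (l.map f).prod * (l.map g).prod := by
  induction l with
  | nil => simp
  | cons a l ih =>
    simp only [List.map_cons, List.prod_cons]
    rw [ih fun i hi j hj => h i (by simp [hi]) j (by simp [hj])]
    have hc : Commute (g a) (l.map f).prod := by
      refine Commute.list_prod_right _ _ fun b hb => ?_
      obtain ⟨j, hj, rfl⟩ := List.mem_map.1 hb
      exact h a (by simp) j (by simp [hj])
    rw [mul_assoc, mul_assoc, ← mul_assoc (g a), hc.eq, mul_assoc]

variable {A : Subgroup G} (hA : ∀ a ∈ A, ∀ b ∈ A, Commute a b)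
include hA

theorem exists_zpow_prod_of_mem_closure {l : List ι} (hl : l.Nodup) {f : ι → G}
    (hf : ∀ i ∈ l, f i ∈ A) {g : G} (hg : g ∈ Subgroup.closure {g | ∃ i ∈ l, g = f i}) :
    ∃ e : ι → ℤ, g = (l.map fun i => f i ^ e i).prod := by
  classical
  have hc : ∀ e e' : ι → ℤ, ∀ i ∈ l, ∀ j ∈ l, Commute (f i ^ e i) (f j ^ e' j) :=
    fun e e' i hi j hj => hA _ (zpow_mem (hf i hi) _) _ (zpow_mem (hf j hj) _)
  induction hg using Subgroup.closure_induction with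
  | mem g h =>
    obtain ⟨i, hi, rfl⟩ := h
    refine ⟨Pi.single i 1, ?_⟩
    rw [List.prod_map_eq_pow_single i _ fun j hj _ => by simp [hj],
      List.count_eq_one_of_mem hl hi]
    simp
  | one => exact ⟨0, by simp⟩
  | mul g h _ _ ihg ihh =>
    obtain ⟨e, rfl⟩ := ihg
    obtain ⟨e', rfl⟩ := ihh
    refine ⟨e + e', ?_⟩
    simp only [Pi.add_apply, zpow_add]
    exact (list_prod_map_mul_of_commute (hc e' e)).symm
  | inv g _ ih =>
    obtain ⟨e, rfl⟩ := ih
    refine ⟨-e, ?_⟩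
    rw [inv_eq_iff_mul_eq_one, ← list_prod_map_mul_of_commute (hc (-e) e)]
    simp

theorem exists_pow_prod_of_mem_closure {l : List ι} (hl : l.Nodup) {f : ι → G} {n : ι → ℕ}
    (hn : ∀ i ∈ l, 0 < n i) (hfn : ∀ i ∈ l, f i ^ n i = 1)
    (hf : ∀ i ∈ l, f i ∈ A) {g : G} (hg : g ∈ Subgroup.closure {g | ∃ i ∈ l, g = f i}) :
    ∃ e : ι → ℕ, (∀ i ∈ l, e i < n i) ∧ g = (l.map fun i => f i ^ e i).prod := by
  obtain ⟨e, rfl⟩ := exists_zpow_prod_of_mem_closure hA hl hf hg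
  have : ∀ i, ∃ m : ℕ, i ∈ l → m < n i ∧ f i ^ m = f i ^ e i := fun i => by
    by_cases hi : i ∈ l
    · obtain ⟨m, hm⟩ := exists_pow_lt_eq_zpow (hn i hi) (hfn i hi) (e i)
      exact ⟨m, fun _ => hm⟩
    · exact ⟨0, fun h => absurd h hi⟩
  choose m hm using this
  refine ⟨m, fun i hi => (hm i hi).1, ?_⟩
  congr 1
  exact List.map_congr_left fun i hi => ((hm i hi).2).symm

theorem exists_mul_of_mem_closure_union {S T : Set G} (hS : S ⊆ A) (hT : T ⊆ A) {g : G}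
    (hg : g ∈ Subgroup.closure (S ∪ T)) :
    ∃ a ∈ Subgroup.closure S, ∃ b ∈ Subgroup.closure T, g = a * b := by
  have hSA : Subgroup.closure S ≤ A := (Subgroup.closure_le A).2 hS
  have hTA : Subgroup.closure T ≤ A := (Subgroup.closure_le A).2 hT
  induction hg using Subgroup.closure_induction with
  | mem g h =>
    rcases h with h | h
    · exact ⟨g, Subgroup.subset_closure h, 1, one_mem _, by simp⟩
    · exact ⟨1, one_mem _, g, Subgroup.subset_closure h, by simp⟩
  | one => exact ⟨1, one_mem _, 1, one_mem _, by simp⟩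
  | mul g h _ _ ihg ihh =>
    obtain ⟨a, ha, b, hb, rfl⟩ := ihg
    obtain ⟨c, hc, d, hd, rfl⟩ := ihh
    refine ⟨a * c, mul_mem ha hc, b * d, mul_mem hb hd, ?_⟩
    exact (hA _ (hTA hb) _ (hSA hc)).mul_mul_mul_comm _ _
  | inv g _ ih =>
    obtain ⟨a, ha, b, hb, rfl⟩ := ih
    exact ⟨a⁻¹, inv_mem ha, b⁻¹, inv_mem hb, by
      rw [(hA _ (hSA ha) _ (hTA hb)).mul_inv]⟩

end Lists

theorem mem_pairs {r : ℕ} {p : Fin r × Fin r} : p ∈ pairs r ↔ p.1 < p.2 := by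
  obtain ⟨i, j⟩ := p
  simp [pairs]

theorem mem_triples {r : ℕ} {p : Fin r × Fin r × Fin r} :
    p ∈ triples r ↔ p.1 < p.2.1 ∧ p.2.1 < p.2.2 := by
  obtain ⟨i, j, k⟩ := p
  simp [triples]

theorem nodup_pairs (r : ℕ) : (pairs r).Nodup :=
  ((List.nodup_finRange r).product (List.nodup_finRange r)).filter _

theorem nodup_triples (r : ℕ) : (triples r).Nodup :=
  ((List.nodup_finRange r).product
    ((List.nodup_finRange r).product (List.nodup_finRange r))).filter _

/-! ### Generators modulo basic commutators. -/

section NormalForm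

variable {G : Type*} [Group G] {r : ℕ} (X : Fin r → G)

/-- The commutators that occur in the normal form. -/
def commutatorGens : Set G :=
  {g | ∃ p ∈ pairs r, g = comm (X p.2) (X p.1)} ∪
  ({g | ∃ p ∈ pairs r, g = comm (X p.2) (X p.1 ^ 2)} ∪
  ({g | ∃ p ∈ pairs r, g = comm (X p.2 ^ 2) (X p.1)} ∪
  ({g | ∃ p ∈ triples r, g = comm (comm (X p.2.1) (X p.1)) (X p.2.2)} ∪
   {g | ∃ p ∈ triples r, g = comm (comm (X p.2.2) (X p.1)) (X p.2.1)})))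

variable (hG : (⊤ : Subgroup G).lowerCentralSeries 3 = ⊥)
include hG

theorem comm_comm_gen_mem_closure {i j : Fin r} (hij : i < j) (k : Fin r) :
    comm (comm (X j) (X i)) (X k) ∈ Subgroup.closure (commutatorGens X) := by
  have hc : ∀ i j : Fin r, i < j → comm (X j) (X i) ∈ Subgroup.closure (commutatorGens X) :=
    fun i j h => Subgroup.subset_closure (Or.inl ⟨(i, j), mem_pairs.2 h, rfl⟩)
  have hw : ∀ i j k : Fin r, i < j → j < k →
      comm (comm (X j) (X i)) (X k) ∈ Subgroup.closure (commutatorGens X) :=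
    fun i j k h h' => Subgroup.subset_closure
      (Or.inr (Or.inr (Or.inr (Or.inl ⟨(i, j, k), mem_triples.2 ⟨h, h'⟩, rfl⟩))))
  have hw' : ∀ i j k : Fin r, i < j → j < k →
      comm (comm (X k) (X i)) (X j) ∈ Subgroup.closure (commutatorGens X) :=
    fun i j k h h' => Subgroup.subset_closure
      (Or.inr (Or.inr (Or.inr (Or.inr ⟨(i, j, k), mem_triples.2 ⟨h, h'⟩, rfl⟩))))
  rcases lt_trichotomy k i with hki | rfl | hki
  -- When the last entry has the smallest index, the Jacobi identity rewrites the commutator through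
  -- the two basic ones.
  · have hJ := comm_jacobi hG (X j) (X i) (X k)
    have hinv : comm (comm (X k) (X j)) (X i) = (comm (comm (X j) (X k)) (X i))⁻¹ := by
      rw [← comm_inv (X j) (X k), comm_inv_left_of_mem hG (comm_mem_one _ _)]
    rw [hinv, mul_inv_eq_one] at hJ
    rw [eq_mul_inv_of_mul_eq hJ]
    exact mul_mem (hw' k i j hki hij) (inv_mem (hw k i j hki hij))
  · have h : comm (X j) (X k ^ 2) ∈ Subgroup.closure (commutatorGens X) :=
      Subgroup.subset_closure (Or.inr (Or.inl ⟨(k, j), mem_pairs.2 hij, rfl⟩))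
    rw [comm_sq_right hG] at h
    exact (Subgroup.mul_mem_cancel_left _ (pow_mem (hc _ _ hij) 2)).1 h
  · rcases lt_trichotomy k j with hkj | rfl | hkj
    · exact hw' i k j hki hkj
    · have h : comm (X k ^ 2) (X i) ∈ Subgroup.closure (commutatorGens X) :=
        Subgroup.subset_closure (Or.inr (Or.inr (Or.inl ⟨(i, k), mem_pairs.2 hij, rfl⟩)))
      rw [comm_sq_left hG] at h
      exact (Subgroup.mul_mem_cancel_left _ (pow_mem (hc _ _ hij) 2)).1 h
    · exact hw i j k hij hkj

omit hG in
theorem commutatorGens_subset : commutatorGens X ⊆ (⊤ : Subgroup G).lowerCentralSeries 1 := by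
  rintro g (⟨p, -, rfl⟩ | ⟨p, -, rfl⟩ | ⟨p, -, rfl⟩ | ⟨p, -, rfl⟩ | ⟨p, -, rfl⟩) <;>
    exact comm_mem_one _ _

variable (hgen : Subgroup.closure (Set.range X) = ⊤)
include hgen

theorem comm_comm_mem_closure {i j : Fin r} (hij : i < j) (g : G) :
    comm (comm (X j) (X i)) g ∈ Subgroup.closure (commutatorGens X) := by
  have hc := comm_mem_one (X j) (X i)
  have hg : g ∈ Subgroup.closure (Set.range X) := hgen ▸ Subgroup.mem_top g
  induction hg using Subgroup.closure_induction with
  | mem g h =>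
    obtain ⟨k, rfl⟩ := h
    exact comm_comm_gen_mem_closure X hG hij k
  | one => rw [comm_one_right]; exact one_mem _
  | mul g h _ _ ihg ihh => rw [comm_mul_right hG hc]; exact mul_mem ihg ihh
  | inv g _ ih => rw [comm_inv_right_of_mem hG hc]; exact inv_mem ih

/-- It suffices that `[s, g]` stays in the subgroup for each generator `s`; for the squared entries
only the factor `[x_j, x_i]^2` matters, the rest being central. -/
theorem closure_commutatorGens_normal : (Subgroup.closure (commutatorGens X)).Normal := by
  have hpair : ∀ p ∈ pairs r, ∀ z ∈ (⊤ : Subgroup G).lowerCentralSeries 2, ∀ g,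
      comm (comm (X p.2) (X p.1) ^ 2 * z) g ∈ Subgroup.closure (commutatorGens X) := by
    intro p hp z hz g
    rw [comm_mul_left hG (pow_mem (comm_mem_one _ _) 2),
      comm_eq_one_iff.2 (commute_of_mem_two hG hz g), mul_one,
      comm_pow_left_of_mem hG (comm_mem_one _ _)]
    exact pow_mem (comm_comm_mem_closure X hG hgen (mem_pairs.1 hp) g) 2
  have htriple : ∀ a b c g : G,
      comm (comm (comm a b) c) g ∈ Subgroup.closure (commutatorGens X) := by
    intro a b c g
    rw [comm_eq_one_iff.2 (commute_of_mem_two hG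
      (comm_mem_lowerCentralSeries (comm_mem_one a b) c) g)]
    exact one_mem _
  have key : ∀ s ∈ commutatorGens X, ∀ g,
      comm s g ∈ Subgroup.closure (commutatorGens X) := by
    rintro s (⟨p, hp, rfl⟩ | ⟨p, hp, rfl⟩ | ⟨p, hp, rfl⟩ | ⟨p, hp, rfl⟩ | ⟨p, hp, rfl⟩) g
    · exact comm_comm_mem_closure X hG hgen (mem_pairs.1 hp) g
    · rw [comm_sq_right hG]
      exact hpair p hp _ (comm_mem_lowerCentralSeries (comm_mem_one _ _) _) g
    · rw [comm_sq_left hG]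
      exact hpair p hp _ (comm_mem_lowerCentralSeries (comm_mem_one _ _) _) g
    · exact htriple _ _ _ g
    · exact htriple _ _ _ g
  refine ⟨fun n hn g => ?_⟩
  induction hn using Subgroup.closure_induction with
  | mem s hs =>
    have : g * s * g⁻¹ = s * comm s g⁻¹ := by simp only [comm]; group
    rw [this]
    exact mul_mem (Subgroup.subset_closure hs) (key s hs g⁻¹)
  | one => simp
  | mul a b _ _ iha ihb => simpa [mul_assoc] using mul_mem iha ihb
  | inv a _ ih => simpa [mul_assoc] using inv_mem ih

/-- Modulo the normal subgroup of basic commutators the generators commute, so the quotient is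
abelian and its elements are ordered products of powers. -/
theorem exists_gen_prod_mul {n : Fin r → ℕ} (hn : ∀ i, 0 < n i) (hX : ∀ i, X i ^ n i = 1)
    (g : G) : ∃ e : Fin r → ℕ, (∀ i, e i < n i) ∧
      ∃ m ∈ Subgroup.closure (commutatorGens X),
        g = ((List.finRange r).map fun i => X i ^ e i).prod * m := by
  have hN := closure_commutatorGens_normal X hG hgen
  let M := Subgroup.closure (commutatorGens X)
  let q : G →* G ⧸ M := QuotientGroup.mk' M
  have hlt : ∀ i j, i < j → Commute (q (X j)) (q (X i)) := fun i j h => by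
    rw [commute_iff_eq, ← comm_eq_one_iff, ← map_comm]
    exact (QuotientGroup.eq_one_iff _).2
      (Subgroup.subset_closure (Or.inl ⟨(i, j), mem_pairs.2 h, rfl⟩))
  have hcomm : ∀ i j, Commute (q (X i)) (q (X j)) := fun i j => by
    rcases lt_trichotomy i j with h | rfl | h
    · exact (hlt i j h).symm
    · exact Commute.refl _
    · exact hlt j i h
  have hcl : Subgroup.closure (Set.range fun i => q (X i)) = ⊤ := by
    have h := MonoidHom.map_closure q (Set.range X)
    rw [hgen, ← MonoidHom.range_eq_map,
      MonoidHom.range_eq_top.2 (QuotientGroup.mk'_surjective M), ← Set.range_comp] at h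
    exact h.symm
  have hA : ∀ a ∈ (⊤ : Subgroup (G ⧸ M)), ∀ b ∈ (⊤ : Subgroup (G ⧸ M)), Commute a b := by
    have h1 : ∀ b i, Commute b (q (X i)) := fun b i => by
      have hb : b ∈ Subgroup.closure (Set.range fun i => q (X i)) := hcl ▸ Subgroup.mem_top b
      induction hb using Subgroup.closure_induction with
      | mem b h => obtain ⟨j, rfl⟩ := h; exact hcomm j i
      | one => exact Commute.one_left _
      | mul _ _ _ _ h h' => exact h.mul_left h'
      | inv _ _ h => exact h.inv_left
    intro a _ b _
    have hb : b ∈ Subgroup.closure (Set.range fun i => q (X i)) := hcl ▸ Subgroup.mem_top b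
    induction hb using Subgroup.closure_induction with
    | mem b h => obtain ⟨j, rfl⟩ := h; exact h1 a j
    | one => exact Commute.one_right _
    | mul _ _ _ _ h h' => exact (h trivial).mul_right (h' trivial)
    | inv _ _ h => exact (h trivial).inv_right
  have hset : {g | ∃ i ∈ List.finRange r, g = q (X i)} = Set.range fun i => q (X i) := by
    ext g; simp [eq_comm]
  obtain ⟨e, he, hprod⟩ := exists_pow_prod_of_mem_closure hA (List.nodup_finRange r)
    (f := fun i => q (X i)) (n := n) (fun i _ => hn i)
    (fun i _ => by rw [← map_pow, hX, map_one]) (fun _ _ => Subgroup.mem_top _)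
    (g := q g) (by rw [hset, hcl]; exact Subgroup.mem_top _)
  refine ⟨e, fun i => he i (List.mem_finRange i),
    ((List.finRange r).map fun i => X i ^ e i).prod⁻¹ * g, ?_, by simp⟩
  apply QuotientGroup.eq.1
  change q _ = q g
  rw [hprod, map_list_prod, List.map_map]
  simp [Function.comp_def]

end NormalForm

/-! ### Existence of the normal form. -/

section Eval

variable {G : Type*} [Group G] {r : ℕ} {X : Fin r → G} {α : Fin r → ℕ}

/-- The part of the normal form made of commutators. -/
def Exponents.evalComm (X : Fin r → G) (c : Exponents r) : G :=
  ((pairs r).map fun p =>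
    comm (X p.2) (X p.1) ^ c.ji p.1 p.2 * comm (X p.2) (X p.1 ^ 2) ^ c.jii p.1 p.2 *
      comm (X p.2 ^ 2) (X p.1) ^ c.jij p.1 p.2).prod *
  ((triples r).map fun p =>
    comm (comm (X p.2.1) (X p.1)) (X p.2.2) ^ c.jik p.1 p.2.1 p.2.2 *
      comm (comm (X p.2.2) (X p.1)) (X p.2.1) ^ c.kij p.1 p.2.1 p.2.2).prod

theorem Exponents.eval_eq (X : Fin r → G) (c : Exponents r) :
    c.eval X = ((List.finRange r).map fun i => X i ^ c.gen i).prod * c.evalComm X := by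
  rw [Exponents.eval, Exponents.evalComm, mul_assoc]

variable (hG : (⊤ : Subgroup G).lowerCentralSeries 3 = ⊥)
  (hX : ∀ i, X i ^ 2 ^ α i = 1) (hα_pos : ∀ i, 1 ≤ α i)
include hG hX hα_pos

/-- When `α i = α j`, the order relation of `x_j` gives the halved exponent, which accounts for the
two cases in the range of `c_{jij}`. -/
theorem comm_sq_left_pow_ite (i j : Fin r) :
    comm (X j ^ 2) (X i) ^ (if α i = α j then 2 ^ (α i - 1) else 2 ^ α i) = 1 := by
  have h2 : 2 ^ α i = 2 * 2 ^ (α i - 1) := by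
    rw [← pow_succ', Nat.sub_add_cancel (hα_pos i)]
  split_ifs with h
  · have hi := hX i
    have hj := hX j
    rw [← h, h2] at hj
    rw [h2] at hi
    rw [comm_sq_left_pow hG]
    exact comm_pow_mul_comm_comm_left hG Nat.one_le_two_pow hi hj
  · exact comm_sq_left_pow_eq_one hG _ (hX i)

theorem exists_evalComm_of_mem_closure {m : G} (hm : m ∈ Subgroup.closure (commutatorGens X))
    (e : Fin r → ℕ) (he : ∀ i, e i < 2 ^ α i) :
    ∃ c : Exponents r, c.InRange α ∧ c.gen = e ∧ m = c.evalComm X := by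
  set A := (⊤ : Subgroup G).lowerCentralSeries 1 with hAdef
  have hA : ∀ a ∈ A, ∀ b ∈ A, Commute a b := fun a ha b hb => commute_of_mem_one hG ha hb
  have hsub := commutatorGens_subset X
  have h2 : ∀ i, 2 ^ α i = 2 * 2 ^ (α i - 1) := fun i => by
    rw [← pow_succ', Nat.sub_add_cancel (hα_pos i)]
  obtain ⟨m₁, hm₁, m', hm', rfl⟩ := exists_mul_of_mem_closure_union hA
    (fun _ h => hsub (Or.inl h)) (fun _ h => hsub (Or.inr h)) hm
  obtain ⟨m₂, hm₂, m'', hm'', rfl⟩ := exists_mul_of_mem_closure_union hA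
    (fun _ h => hsub (Or.inr (Or.inl h))) (fun _ h => hsub (Or.inr (Or.inr h))) hm'
  obtain ⟨m₃, hm₃, m''', hm''', rfl⟩ := exists_mul_of_mem_closure_union hA
    (fun _ h => hsub (Or.inr (Or.inr (Or.inl h))))
    (fun _ h => hsub (Or.inr (Or.inr (Or.inr h)))) hm''
  obtain ⟨m₄, hm₄, m₅, hm₅, rfl⟩ := exists_mul_of_mem_closure_union hA
    (fun _ h => hsub (Or.inr (Or.inr (Or.inr (Or.inl h)))))
    (fun _ h => hsub (Or.inr (Or.inr (Or.inr (Or.inr h))))) hm'''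
  obtain ⟨e₁, he₁, rfl⟩ := exists_pow_prod_of_mem_closure hA (nodup_pairs r)
    (n := fun p => 2 ^ (α p.1 + 1)) (fun _ _ => by positivity)
    (fun p _ => by rw [pow_succ', comm_pow_double_eq_one hG _ (hX p.1)])
    (fun _ _ => comm_mem_one _ _) hm₁
  obtain ⟨e₂, he₂, rfl⟩ := exists_pow_prod_of_mem_closure hA (nodup_pairs r)
    (n := fun p => 2 ^ (α p.1 - 1)) (fun _ _ => by positivity)
    (fun p _ => comm_sq_right_pow_eq_one hG Nat.one_le_two_pow _ (by rw [← h2, hX]))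
    (fun _ _ => comm_mem_one _ _) hm₂
  obtain ⟨e₃, he₃, rfl⟩ := exists_pow_prod_of_mem_closure hA (nodup_pairs r)
    (n := fun p => if α p.1 = α p.2 then 2 ^ (α p.1 - 1) else 2 ^ α p.1)
    (fun _ _ => by split_ifs <;> positivity)
    (fun p _ => comm_sq_left_pow_ite hG hX hα_pos p.1 p.2)
    (fun _ _ => comm_mem_one _ _) hm₃
  obtain ⟨e₄, he₄, rfl⟩ := exists_pow_prod_of_mem_closure hA (nodup_triples r)
    (n := fun p => 2 ^ α p.1) (fun _ _ => by positivity)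
    (fun p _ => comm_comm_pow_eq_one_of_right hG _ _ (hX p.1))
    (fun _ _ => comm_mem_one _ _) hm₄
  obtain ⟨e₅, he₅, rfl⟩ := exists_pow_prod_of_mem_closure hA (nodup_triples r)
    (n := fun p => 2 ^ α p.1) (fun _ _ => by positivity)
    (fun p _ => comm_comm_pow_eq_one_of_right hG _ _ (hX p.1))
    (fun _ _ => comm_mem_one _ _) hm₅
  refine ⟨⟨e, fun i j => e₁ (i, j), fun i j => e₂ (i, j), fun i j => e₃ (i, j),
    fun i j k => e₄ (i, j, k), fun i j k => e₅ (i, j, k)⟩, ⟨he, fun i j hij => ?_,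
    fun i j k hij hjk => ?_⟩, rfl, ?_⟩
  · have hp := mem_pairs (p := (i, j)).2 hij
    exact ⟨he₁ _ hp, he₂ _ hp, he₃ _ hp⟩
  · have hp := mem_triples (p := (i, j, k)).2 ⟨hij, hjk⟩
    exact ⟨he₄ _ hp, he₅ _ hp⟩
  · have hc : ∀ (a b c d : G) (n k : ℕ), Commute (comm a b ^ n) (comm c d ^ k) :=
      fun a b c d n k => hA _ (pow_mem (comm_mem_one _ _) _) _ (pow_mem (comm_mem_one _ _) _)
    simp only [Exponents.evalComm]
    rw [list_prod_map_mul_of_commute fun _ _ _ _ => (hc _ _ _ _ _ _).mul_right (hc _ _ _ _ _ _),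
      list_prod_map_mul_of_commute fun _ _ _ _ => hc _ _ _ _ _ _,
      list_prod_map_mul_of_commute fun _ _ _ _ => hc _ _ _ _ _ _]
    simp only [mul_assoc]

theorem exists_eval (hgen : Subgroup.closure (Set.range X) = ⊤) (g : G) :
    ∃ c : Exponents r, c.InRange α ∧ g = c.eval X := by
  obtain ⟨e, he, m, hm, rfl⟩ := exists_gen_prod_mul X hG hgen (n := fun i => 2 ^ α i)
    (fun _ => by positivity) hX g
  obtain ⟨c, hc, rfl, rfl⟩ := exists_evalComm_of_mem_closure hG hX hα_pos hm e he
  exact ⟨c, hc, (c.eval_eq X).symm⟩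

omit hX hα_pos in
-- Shows why `c_{ji} + 2 c_{jii} + 2 c_{jij}` governs centrality: it is the exponent of `[x_j, x_i]`
-- once the weight-three part is split off.
theorem pair_factor_eq (x y : G) (k l m : ℕ) :
    comm y x ^ k * comm y (x ^ 2) ^ l * comm (y ^ 2) x ^ m =
      comm y x ^ (k + 2 * l + 2 * m) * (comm (comm y x) x ^ l * comm (comm y x) y ^ m) := by
  have hc := comm_mem_one y x
  have hu := comm_mem_lowerCentralSeries hc x
  have hv := comm_mem_lowerCentralSeries hc y
  have hcu : Commute (comm y x ^ 2) (comm (comm y x) x) := (commute_of_mem_two hG hu _).symm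
  have hcv : Commute (comm y x ^ 2) (comm (comm y x) y) := (commute_of_mem_two hG hv _).symm
  rw [comm_sq_right hG, comm_sq_left hG, hcu.mul_pow, hcv.mul_pow, ← pow_mul, ← pow_mul,
    pow_add, pow_add]
  have := commute_of_mem_two hG (pow_mem hu l) (comm y x ^ (2 * m))
  simp only [mul_assoc]
  rw [← mul_assoc (comm (comm y x) x ^ l), this, mul_assoc]

omit hX hα_pos in
/-- Modulo central elements, the commutator part of a normal form is a product of powers of
commutators of weight two. -/
theorem evalComm_eq_mul_mem_two (c : Exponents r) :
    ∃ z ∈ (⊤ : Subgroup G).lowerCentralSeries 2, c.evalComm X =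
      ((pairs r).map fun p => comm (X p.2) (X p.1) ^ c.alpha p.1 p.2).prod * z := by
  have hcc : ∀ (a b d : G) (n : ℕ),
      comm (comm a b) d ^ n ∈ (⊤ : Subgroup G).lowerCentralSeries 2 := fun a b d n =>
    pow_mem (comm_mem_lowerCentralSeries (comm_mem_one a b) d) n
  refine ⟨((pairs r).map fun p => comm (comm (X p.2) (X p.1)) (X p.1) ^ c.jii p.1 p.2 *
    comm (comm (X p.2) (X p.1)) (X p.2) ^ c.jij p.1 p.2).prod *
    ((triples r).map fun p => comm (comm (X p.2.1) (X p.1)) (X p.2.2) ^ c.jik p.1 p.2.1 p.2.2 *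
      comm (comm (X p.2.2) (X p.1)) (X p.2.1) ^ c.kij p.1 p.2.1 p.2.2).prod, mul_mem
      (list_prod_mem fun p _ => mul_mem (hcc _ _ _ _) (hcc _ _ _ _))
      (list_prod_mem fun p _ => mul_mem (hcc _ _ _ _) (hcc _ _ _ _)), ?_⟩
  rw [Exponents.evalComm, ← mul_assoc, ← list_prod_map_mul_of_commute fun p _ q _ =>
    commute_of_mem_two hG (mul_mem (hcc _ _ _ _) (hcc _ _ _ _)) _]
  simp only [pair_factor_eq hG, Exponents.alpha]

end Eval

/-! ### Central elements and the generators of the centre. -/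

section Center

variable {G : Type*} [Group G] (hG : (⊤ : Subgroup G).lowerCentralSeries 3 = ⊥)
include hG

/-- Identifies a generator in (b) as a weight-three commutator: `[y, x^2]` contributes `[y, x]^2`,
completing the exponent to `2n`. -/
theorem comm_pow_mul_comm_sq_right {n : ℕ} {x : G} (y : G) (hn : 1 ≤ n) (hx : x ^ n = 1) :
    comm y x ^ (2 * n - 2) * comm y (x ^ 2) = comm (comm y x) x := by
  rw [comm_sq_right hG, ← mul_assoc, ← pow_add, Nat.sub_add_cancel (by omega),
    comm_pow_double_eq_one hG y hx, one_mul]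

theorem comm_pow_mul_comm_sq_left {n : ℕ} {x : G} (y : G) (hn : 1 ≤ n) (hx : x ^ n = 1) :
    comm y x ^ (2 * n - 2) * comm (y ^ 2) x = comm (comm y x) y := by
  rw [comm_sq_left hG, ← mul_assoc, ← pow_add, Nat.sub_add_cancel (by omega),
    comm_pow_double_eq_one hG y hx, one_mul]

variable {r : ℕ} {X : Fin r → G} {α : Fin r → ℕ} (hX : ∀ i, X i ^ 2 ^ α i = 1)
include hX

theorem pow_last_mem_center (hgen : Subgroup.closure (Set.range X) = ⊤) {l : Fin r} {n : ℕ}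
    (hn : ∀ i, i ≠ l → α i + 1 ≤ n) : X l ^ 2 ^ n ∈ Subgroup.center G := by
  rw [Subgroup.mem_center_iff]
  intro g
  have hg : g ∈ Subgroup.closure (Set.range X) := hgen ▸ Subgroup.mem_top g
  rw [← commute_iff_eq]
  induction hg using Subgroup.closure_induction with
  | mem g h =>
    obtain ⟨i, rfl⟩ := h
    by_cases hi : i = l
    · subst hi
      exact (Commute.refl _).pow_right _
    · refine (comm_eq_one_iff.1 (comm_pow_left_eq_one hG (X l) (hX i) ?_)).symm
      rw [← pow_succ']
      exact pow_dvd_pow 2 (hn i hi)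
  | one => exact Commute.one_left _
  | mul _ _ _ _ h h' => exact h.mul_left h'
  | inv _ _ h => exact h.inv_left

omit hX in
-- Needs only the congruences, not the ranges; it is applied to the subgroup generated by the set in
-- (b).
theorem eval_mem {K : Subgroup G} {l : Fin r} {n : ℕ} (hl : X l ^ n ∈ K)
    (hp : ∀ i j, i < j → comm (X j) (X i) ^ 2 ^ α i ∈ K)
    (hu : ∀ i j, i < j → comm (comm (X j) (X i)) (X i) ∈ K)
    (hv : ∀ i j, i < j → comm (comm (X j) (X i)) (X j) ∈ K)
    (hw : ∀ i j k, i < j → j < k → comm (comm (X j) (X i)) (X k) ∈ K)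
    (hw' : ∀ i j k, i < j → j < k → comm (comm (X k) (X i)) (X j) ∈ K)
    {c : Exponents r} (hgen : ∀ i, i ≠ l → c.gen i = 0) (hc : n ∣ c.gen l)
    (hα : ∀ i j, i < j → 2 ^ α i ∣ c.alpha i j) : c.eval X ∈ K := by
  have hdvd : ∀ {g : G} {m k : ℕ}, g ^ m ∈ K → m ∣ k → g ^ k ∈ K := by
    rintro g m _ hg ⟨k, rfl⟩
    rw [pow_mul]
    exact pow_mem hg k
  rw [Exponents.eval_eq, Exponents.evalComm]
  refine mul_mem (list_prod_mem fun i _ => ?_)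
    (mul_mem (list_prod_mem fun p hp' => ?_) (list_prod_mem fun p hp' => ?_))
  · by_cases hi : i = l
    · exact hi ▸ hdvd hl hc
    · rw [hgen i hi, pow_zero]
      exact one_mem _
  · have h := mem_pairs.1 hp'
    rw [pair_factor_eq hG]
    exact mul_mem (hdvd (hp _ _ h) (hα _ _ h))
      (mul_mem (pow_mem (hu _ _ h) _) (pow_mem (hv _ _ h) _))
  · obtain ⟨h, h'⟩ := mem_triples.1 hp'
    exact mul_mem (pow_mem (hw _ _ _ h h') _) (pow_mem (hw' _ _ _ h h') _)

end Center

/-! ### The test rings. -/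

section TestRing

open Polynomial

/-- Take `ℤ[X]/(X^3, f)` with `N` the class of `X`. If `a X^3 + b f` has no terms below a given
degree at most two, then neither has `b`, as `f(0) = n ≠ 0`; so its coefficient in that degree is a
multiple of `n`. -/
theorem exists_testRing (f : ℤ[X]) {n : ℕ} (hn : n ≠ 0) (hf : f.coeff 0 = n) :
    ∃ (R : Type) (_ : CommRing R) (N : R), N ^ 3 = 0 ∧ f.eval₂ (Int.castRingHom R) N = 0 ∧
      (∀ (p : ℕ) (s : R), p * N + N ^ 2 * s = 0 → n ∣ p) ∧
      ∀ p : ℕ, p * N ^ 2 = 0 → n ∣ p := by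
  let I : Ideal ℤ[X] := Ideal.span {X ^ 3, f}
  have hmem : ∀ g : ℤ[X], Ideal.Quotient.mk I g = 0 → ∃ a b, a * X ^ 3 + b * f = g :=
    fun g hg => Ideal.mem_span_pair.1 (Ideal.Quotient.eq_zero_iff_mem.1 hg)
  refine ⟨ℤ[X] ⧸ I, inferInstance, Ideal.Quotient.mk I X, ?_, ?_, ?_, ?_⟩
  · rw [← map_pow]
    exact Ideal.Quotient.eq_zero_iff_mem.2 (Ideal.subset_span (by simp))
  · have : f.eval₂ (Int.castRingHom (ℤ[X] ⧸ I)) (Ideal.Quotient.mk I X) =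
        Ideal.Quotient.mk I f := by
      conv_rhs => rw [← eval₂_C_X (p := f), hom_eval₂]
      congr 1
    rw [this]
    exact Ideal.Quotient.eq_zero_iff_mem.2 (Ideal.subset_span (by simp))
  · intro p s h
    obtain ⟨s, rfl⟩ := Ideal.Quotient.mk_surjective s
    obtain ⟨a, b, hab⟩ := hmem (C (p : ℤ) * X + X ^ 2 * s) (by simpa using h)
    have h0 := congrArg (fun g => coeff g 0) hab
    have h1 := congrArg (fun g => coeff g 1) hab
    simp [mul_coeff_zero, hf, hn] at h0
    simp [mul_coeff_one, hf, h0, coeff_X_pow] at h1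
    exact Int.natCast_dvd_natCast.1 ⟨b.coeff 1, by rw [← h1, mul_comm]⟩
  · intro p h
    obtain ⟨a, b, hab⟩ := hmem (C (p : ℤ) * X ^ 2) (by simpa using h)
    have h0 := congrArg (fun g => coeff g 0) hab
    have h1 := congrArg (fun g => coeff g 1) hab
    have h2 := congrArg (fun g => coeff g 2) hab
    simp [mul_coeff_zero, hf, hn] at h0
    simp [mul_coeff_one, hf, h0, coeff_X_pow, hn] at h1
    simp [coeff_mul, Finset.Nat.antidiagonal_succ, hf, h0, h1, coeff_X_pow] at h2
    exact Int.natCast_dvd_natCast.1 ⟨b.coeff 2, by rw [← h2, mul_comm]⟩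

theorem one_add_pow_of_cube_eq_zero {R : Type*} [CommRing R] {N : R} (hN : N ^ 3 = 0) (m : ℕ) :
    (1 + N) ^ m = 1 + m * N + m.choose 2 * N ^ 2 := by
  induction m with
  | zero => simp
  | succ m ih =>
    rw [pow_succ, ih, Nat.choose_succ_succ' m 1, Nat.choose_one_right]
    push_cast
    linear_combination (m.choose 2 : R) * hN

end TestRing

/-! ### Affine groups of class three. -/

/-- The group of affine transformations `z ↦ t z + v` of a commutative ring. -/
@[ext]
structure Aff (R : Type*) [CommRing R] where
  /-- The translation part. -/
  v : R
  /-- The linear part. -/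
  t : Rˣ

namespace Aff

variable {R : Type*} [CommRing R]

instance : Mul (Aff R) := ⟨fun g h => ⟨g.v + g.t * h.v, g.t * h.t⟩⟩
instance : One (Aff R) := ⟨⟨0, 1⟩⟩
instance : Inv (Aff R) := ⟨fun g => ⟨-(↑g.t⁻¹ * g.v), g.t⁻¹⟩⟩

@[simp] theorem mul_v (g h : Aff R) : (g * h).v = g.v + g.t * h.v := rfl
@[simp] theorem mul_t (g h : Aff R) : (g * h).t = g.t * h.t := rfl
@[simp] theorem one_v : (1 : Aff R).v = 0 := rfl
@[simp] theorem one_t : (1 : Aff R).t = 1 := rfl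
@[simp] theorem inv_v (g : Aff R) : g⁻¹.v = -(↑g.t⁻¹ * g.v) := rfl
@[simp] theorem inv_t (g : Aff R) : g⁻¹.t = g.t⁻¹ := rfl

instance : Group (Aff R) :=
  Group.ofLeftAxioms
    (fun a b c => by ext <;> simp [mul_add, mul_assoc, add_assoc])
    (fun a => by ext <;> simp)
    (fun a => by ext <;> simp)

theorem pow_t (g : Aff R) (n : ℕ) : (g ^ n).t = g.t ^ n := by
  induction n with
  | zero => simp
  | succ n ih => rw [pow_succ, mul_t, ih, pow_succ]

theorem pow_v (g : Aff R) (n : ℕ) :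
    (g ^ n).v = (∑ k ∈ Finset.range n, (g.t : R) ^ k) * g.v := by
  induction n with
  | zero => simp
  | succ n ih =>
    rw [pow_succ, mul_v, ih, pow_t, Finset.sum_range_succ]
    push_cast
    ring

/-- The affine transformations whose linear part is `1` modulo `N`. -/
def congruenceSubgroup (N : R) : Subgroup (Aff R) where
  carrier := {g | N ∣ (g.t : R) - 1}
  one_mem' := by simp
  mul_mem' := by
    rintro g h ⟨a, ha⟩ ⟨b, hb⟩
    exact ⟨a * h.t + b, by simp only [mul_t, Units.val_mul]; linear_combination (h.t : R) * ha + hb⟩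
  inv_mem' := by
    rintro g ⟨a, ha⟩
    refine ⟨-(a * (↑g.t⁻¹ : R)), ?_⟩
    have := g.t.mul_inv
    simp only [inv_t]
    linear_combination (-(↑g.t⁻¹ : R)) * ha + this

/-- The translations by multiples of `M`. -/
def translationSubgroup (M : R) : Subgroup (Aff R) where
  carrier := {g | g.t = 1 ∧ M ∣ g.v}
  one_mem' := by simp
  mul_mem' := by
    rintro g h ⟨hg, a, ha⟩ ⟨hh, b, hb⟩
    exact ⟨by simp [hg, hh], a + b, by simp [hg, ha, hb, mul_add]⟩
  inv_mem' := by
    rintro g ⟨hg, a, ha⟩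
    exact ⟨by simp [hg], -a, by simp [hg, ha]⟩

open scoped commutatorElement in
-- Linear parts commute, so the commutator is the translation by `(g.t - 1) h.v - (h.t - 1) g.v`.
theorem commutator_congruenceSubgroup_le (N : R) :
    ⁅congruenceSubgroup N, congruenceSubgroup N⁆ ≤ translationSubgroup N := by
  rw [Subgroup.commutator_le]
  rintro g ⟨a, ha⟩ h ⟨b, hb⟩
  have h1 := g.t.mul_inv
  have h2 := h.t.mul_inv
  refine ⟨by simp [commutatorElement_def], a * h.v - b * g.v, ?_⟩
  simp only [commutatorElement_def, mul_v, mul_t, inv_v, inv_t, Units.val_mul]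
  linear_combination h.v * ha - g.v * hb - (h.t : R) * g.v * h1 -
    h.v * (h2 + (h.t : R) * ↑h.t⁻¹ * h1)

open scoped commutatorElement in
theorem commutator_translationSubgroup_le (M N : R) :
    ⁅translationSubgroup M, congruenceSubgroup N⁆ ≤ translationSubgroup (M * N) := by
  rw [Subgroup.commutator_le]
  rintro g ⟨hg, a, ha⟩ h ⟨b, hb⟩
  have h2 := h.t.mul_inv
  refine ⟨by simp [commutatorElement_def], -(a * b), ?_⟩
  simp only [commutatorElement_def, mul_v, mul_t, inv_v, inv_t, hg, ha,
    Units.val_one, inv_one, one_mul, mul_one]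
  linear_combination (- M * a) * hb - h.v * h2

/-- Each further commutator multiplies the translations by `N`, so weight four lands in multiples of
`N^3 = 0`. -/
theorem map_lowerCentralSeries_three {N : R} (hN : N ^ 3 = 0) {F : Type*} [Group F]
    (φ : F →* Aff R) (hφ : ∀ g, φ g ∈ congruenceSubgroup N) :
    (⊤ : Subgroup F).lowerCentralSeries 3 ≤ φ.ker := by
  have h0 : (⊤ : Subgroup F).map φ ≤ congruenceSubgroup N := by
    rintro _ ⟨g, -, rfl⟩
    exact hφ g
  have h1 : ((⊤ : Subgroup F).lowerCentralSeries 1).map φ ≤ translationSubgroup N := by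
    rw [Subgroup.lowerCentralSeries_succ, Subgroup.map_commutator]
    exact (Subgroup.commutator_mono h0 h0).trans (commutator_congruenceSubgroup_le N)
  have h2 : ((⊤ : Subgroup F).lowerCentralSeries 2).map φ ≤ translationSubgroup (N * N) := by
    rw [Subgroup.lowerCentralSeries_succ, Subgroup.map_commutator]
    exact (Subgroup.commutator_mono h1 h0).trans (commutator_translationSubgroup_le N N)
  have h3 : ((⊤ : Subgroup F).lowerCentralSeries 3).map φ ≤ translationSubgroup (N * N * N) := by
    rw [Subgroup.lowerCentralSeries_succ, Subgroup.map_commutator]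
    exact (Subgroup.commutator_mono h2 h0).trans (commutator_translationSubgroup_le _ N)
  intro g hg
  obtain ⟨ht, a, ha⟩ := h3 ⟨g, hg, rfl⟩
  rw [MonoidHom.mem_ker]
  ext
  · rw [ha, show N * N * N = N ^ 3 by ring, hN, zero_mul, one_v]
  · rw [ht, one_t]

end Aff

theorem list_prod_map_eq_of_nodup {M ι : Type*} [Monoid M] {l : List ι} (hl : l.Nodup)
    {f : ι → M} {i : ι} (hi : i ∈ l) (hf : ∀ j, j ≠ i → j ∈ l → f j = 1) :
    (l.map f).prod = f i := by
  classical
  rw [List.prod_map_eq_pow_single i f hf, List.count_eq_one_of_mem hl hi, pow_one]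

theorem list_prod_map_eq_of_pairwise {M ι : Type*} [Monoid M] [LinearOrder ι] {l : List ι}
    (hl : l.Pairwise (· < ·)) {f : ι → M} {i j : ι} (hij : i < j) (hi : i ∈ l) (hj : j ∈ l)
    (hf : ∀ k, k ≠ i → k ≠ j → f k = 1) : (l.map f).prod = f i * f j := by
  induction l with
  | nil => simp at hi
  | cons a l ih =>
    rw [List.pairwise_cons] at hl
    rw [List.map_cons, List.prod_cons]
    rw [List.mem_cons] at hi hj
    rcases hi with rfl | hi
    · have hj := hj.resolve_left hij.ne'
      have hnd : l.Nodup := hl.2.imp ne_of_lt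
      rw [list_prod_map_eq_of_nodup hnd hj fun k hkj hk => hf k (hl.1 k hk).ne' hkj]
    · have hai := hl.1 i hi
      have hj := hj.resolve_left (hai.trans hij).ne'
      rw [hf a hai.ne (hai.trans hij).ne, one_mul, ih hl.2 hi hj]

namespace Aff

variable {R : Type*} [CommRing R]

/-- Commuting with `y` gives `N * g.v = 0`; commuting with `x` then forces the linear part of `g` to
be `1`. As `g.v` is `p` modulo `N`, `h1` gives `p = 0`; what is left of `g.v` is `A` times the
translation part of `[y, x]`, a unit times `N`, so `A * N ^ 2 = 0`. -/
theorem commute_analysis {N : R} {n : ℕ}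
    (h1 : ∀ (p : ℕ) (s : R), p * N + N ^ 2 * s = 0 → n ∣ p)
    (h2 : ∀ p : ℕ, p * N ^ 2 = 0 → n ∣ p) {t τ : Rˣ} (ht : (t : R) = 1 + N)
    (hτ : τ = 1 ∨ τ = t) {p q A : ℕ} (hp : p < n)
    (hx : Commute ((⟨1, τ⟩ : Aff R) ^ p * ⟨0, t⟩ ^ q * comm ⟨0, t⟩ ⟨1, τ⟩ ^ A) ⟨1, τ⟩)
    (hy : Commute ((⟨1, τ⟩ : Aff R) ^ p * ⟨0, t⟩ ^ q * comm ⟨0, t⟩ ⟨1, τ⟩ ^ A) ⟨0, t⟩) :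
    p = 0 ∧ n ∣ A ∧ (t : R) ^ q = 1 := by
  set x : Aff R := ⟨1, τ⟩ with hxdef
  set y : Aff R := ⟨0, t⟩ with hydef
  set g := x ^ p * y ^ q * comm y x ^ A with hg
  obtain ⟨m, hm⟩ : ∃ m : R, (τ : R) = 1 + N * m := by
    rcases hτ with rfl | rfl
    · exact ⟨0, by simp⟩
    · exact ⟨1, by simp [ht]⟩
  have hct : (comm y x).t = 1 := by simp [comm]
  have hcv : (t : R) * τ * (comm y x).v = N := by
    have h := congrArg Aff.v (show y * x = x * y * comm y x by simp only [comm]; group)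
    simp only [mul_v, mul_t, hxdef, hydef, Units.val_mul] at h
    linear_combination (-1 : R) * h + ht
  have hgt : g.t = τ ^ p * t ^ q := by
    rw [hg, mul_t, mul_t, pow_t, pow_t, pow_t, hct]
    simp [hxdef, hydef]
  have hgv : g.v = (∑ k ∈ Finset.range p, (τ : R) ^ k) +
      τ ^ p * t ^ q * (A * (comm y x).v) := by
    rw [hg, mul_v, mul_v, mul_t, pow_t, pow_t, pow_v, pow_v, pow_v, hct]
    simp [hxdef, hydef]
  have e1 : N * g.v = 0 := by
    have h := congrArg Aff.v hy.eq
    simp only [mul_v, hydef, mul_zero, add_zero, zero_add] at h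
    linear_combination (-1 : R) * h - g.v * ht
  have e2 : (t : R) ^ q * τ ^ p = 1 := by
    have h := congrArg Aff.v hx.eq
    simp only [mul_v, hxdef, mul_one, hgt, Units.val_mul, Units.val_pow_eq_pow_val] at h
    linear_combination h + g.v * hm + m * e1
  have hN : N * (comm y x).v = N ^ 2 * (↑(t * τ)⁻¹ : R) := by
    have h := (t * τ).mul_inv
    rw [Units.val_mul] at h
    linear_combination N * (↑(t * τ)⁻¹ : R) * hcv - N * (comm y x).v * h
  obtain ⟨w, hw⟩ : ∃ w : R, ∑ k ∈ Finset.range p, (τ : R) ^ k = p + N * w := by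
    have : N ∣ ∑ k ∈ Finset.range p, ((τ : R) ^ k - 1) := by
      refine Finset.dvd_sum fun k _ => dvd_trans ⟨m, ?_⟩ (sub_one_dvd_pow_sub_one (τ : R) k)
      rw [hm]; ring
    obtain ⟨w, hw⟩ := this
    refine ⟨w, ?_⟩
    rw [Finset.sum_sub_distrib] at hw
    simp at hw
    linear_combination hw
  have hp0 : p = 0 := by
    refine Nat.eq_zero_of_dvd_of_lt (h1 p (w + τ ^ p * t ^ q * A * (↑(t * τ)⁻¹ : R)) ?_) hp
    rw [hgv, hw] at e1
    linear_combination e1 - (τ : R) ^ p * t ^ q * A * hN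
  subst hp0
  refine ⟨rfl, h2 A ?_, by simpa using e2⟩
  have hq : (t : R) ^ q = 1 := by simpa using e2
  rw [hgv, hq] at e1
  have h := (t * τ).mul_inv
  rw [Units.val_mul] at h
  simp only [Finset.range_zero, Finset.sum_empty, pow_zero, one_mul, zero_add] at e1
  linear_combination (t : R) * τ * e1 - N * A * hcv

end Aff

/-! ### Homomorphisms from the nilpotent product to affine groups. -/

section Hom

variable {r : ℕ} {C : Fin r → Type*} [∀ i, Group (C i)] {x : ∀ i, C i}
  (hx : ∀ i, Subgroup.zpowers (x i) = ⊤) {α : Fin r → ℕ} (hα : ∀ i, orderOf (x i) = 2 ^ α i)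

theorem lowerCentralSeries_three_eq_bot (C : Fin r → Type*) [∀ i, Group (C i)] :
    (⊤ : Subgroup (NilpotentProduct 3 C)).lowerCentralSeries 3 = ⊥ := by
  have h := Subgroup.map_lowerCentralSeries (⊤ : Subgroup (Monoid.CoprodI C))
    (QuotientGroup.mk' ((⊤ : Subgroup (Monoid.CoprodI C)).lowerCentralSeries 3)) 3
  rw [Subgroup.map_top_of_surjective _ (QuotientGroup.mk'_surjective _)] at h
  rw [← h, eq_bot_iff, Subgroup.map_le_iff_le_comap, MonoidHom.comap_bot, QuotientGroup.ker_mk']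

include hx in
theorem closure_range_inc :
    Subgroup.closure (Set.range fun i => inc 3 C i (x i)) = ⊤ := by
  rw [eq_top_iff]
  intro g hg
  clear hg
  obtain ⟨g, rfl⟩ := QuotientGroup.mk'_surjective _ g
  induction g using Monoid.CoprodI.induction_on with
  | one => rw [map_one]; exact one_mem _
  | of i m =>
    obtain ⟨k, rfl⟩ := Subgroup.mem_zpowers_iff.1 (hx i ▸ Subgroup.mem_top m)
    have : inc 3 C i (x i) ^ k ∈ Subgroup.closure (Set.range fun i => inc 3 C i (x i)) :=
      zpow_mem (Subgroup.subset_closure (Set.mem_range_self i)) k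
    rwa [← map_zpow] at this
  | mul g h ihg ihh => rw [map_mul]; exact mul_mem ihg ihh

include hx hα in
theorem exists_hom_aff {R : Type*} [CommRing R] {N : R} (hN : N ^ 3 = 0) (h : Fin r → Aff R)
    (hh : ∀ i, h i ∈ Aff.congruenceSubgroup N) (hpow : ∀ i, h i ^ 2 ^ α i = 1) :
    ∃ φ : NilpotentProduct 3 C →* Aff R, ∀ i, φ (inc 3 C i (x i)) = h i := by
  have hgen : ∀ i, ∀ z, z ∈ Subgroup.zpowers (x i) := fun i z => hx i ▸ Subgroup.mem_top z
  let f : ∀ i, C i →* Aff R := fun i => monoidHomOfForallMemZpowers (hgen i)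
    (g' := h i) (by rw [hα]; exact orderOf_dvd_of_pow_eq_one (hpow i))
  have hf : ∀ i, f i (x i) = h i := fun i => monoidHomOfForallMemZpowers_apply_gen _ _
  have hφ : ∀ g, Monoid.CoprodI.lift f g ∈ Aff.congruenceSubgroup N := fun g => by
    induction g using Monoid.CoprodI.induction_on with
    | one => rw [map_one]; exact one_mem _
    | of i m =>
      obtain ⟨k, rfl⟩ := Subgroup.mem_zpowers_iff.1 (hgen i m)
      rw [Monoid.CoprodI.lift_of, map_zpow, hf]
      exact zpow_mem (hh i) k
    | mul g h ihg ihh => rw [map_mul]; exact mul_mem ihg ihh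
  refine ⟨QuotientGroup.lift _ (Monoid.CoprodI.lift f)
    (Aff.map_lowerCentralSeries_three hN _ hφ), fun i => ?_⟩
  rw [← hf i]
  exact Monoid.CoprodI.lift_of ..

end Hom

/-! ### Congruences satisfied by central normal forms. -/

section Center

variable {r : ℕ} {C : Fin r → Type*} [∀ i, Group (C i)] {x : ∀ i, C i}
  (hx : ∀ i, Subgroup.zpowers (x i) = ⊤) {α : Fin r → ℕ} (hα : ∀ i, orderOf (x i) = 2 ^ α i)

include hα in
theorem inc_pow_eq_one (i : Fin r) : inc 3 C i (x i) ^ 2 ^ α i = 1 := by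
  rw [← map_pow, ← hα, pow_orderOf_eq_one, map_one]

include hx hα in
/-- What centrality of a normal form says in a quotient that is a group of affine
transformations and where only two of the generators survive. -/
theorem exponents_of_mem_center_aux {R : Type} [CommRing R] {N : R} (hN : N ^ 3 = 0) {n : ℕ}
    (h1 : ∀ (p : ℕ) (s : R), p * N + N ^ 2 * s = 0 → n ∣ p)
    (h2 : ∀ p : ℕ, p * N ^ 2 = 0 → n ∣ p) {t τ : Rˣ} (ht : (t : R) = 1 + N)
    (hτ : τ = 1 ∨ τ = t) {i j : Fin r} (hij : i < j)
    (hxi : (⟨1, τ⟩ : Aff R) ^ 2 ^ α i = 1) (hyj : (⟨0, t⟩ : Aff R) ^ 2 ^ α j = 1)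
    {c : Exponents r} (hc : c.gen i < n)
    (hcen : c.eval (fun i => inc 3 C i (x i)) ∈ Subgroup.center (NilpotentProduct 3 C)) :
    c.gen i = 0 ∧ n ∣ c.alpha i j ∧ (t : R) ^ c.gen j = 1 := by
  have hG := lowerCentralSeries_three_eq_bot C
  obtain ⟨φ, hφ⟩ := exists_hom_aff hx hα hN
    (fun k => if k = i then ⟨1, τ⟩ else if k = j then ⟨0, t⟩ else 1)
    (fun k => by
      have htN : N ∣ (t : R) - 1 := ⟨1, by rw [ht]; ring⟩
      split_ifs
      · rcases hτ with rfl | rfl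
        · simp [Aff.congruenceSubgroup]
        · exact htN
      · exact htN
      · exact one_mem _)
    (fun k => by
      split_ifs with hi hj
      · exact hi ▸ hxi
      · exact hj ▸ hyj
      · exact one_pow _)
  have hφi : φ (inc 3 C i (x i)) = ⟨1, τ⟩ := by simp [hφ]
  have hφj : φ (inc 3 C j (x j)) = ⟨0, t⟩ := by simp [hφ, hij.ne']
  have hφk : ∀ k, k ≠ i → k ≠ j → φ (inc 3 C k (x k)) = 1 := fun k hki hkj => by
    simp [hφ, hki, hkj]
  obtain ⟨z, hz, hceq⟩ := evalComm_eq_mul_mem_two (X := fun i => inc 3 C i (x i)) hG c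
  -- The factor `z` from `G_3` is central, so it can be dropped.
  rw [Exponents.eval_eq, hceq, ← mul_assoc,
    Subgroup.mul_mem_cancel_right _ (lowerCentralSeries_two_le_center hG hz)] at hcen
  have himg : φ (((List.finRange r).map fun i => inc 3 C i (x i) ^ c.gen i).prod *
      ((pairs r).map fun p => comm (inc 3 C p.2 (x p.2)) (inc 3 C p.1 (x p.1)) ^
        c.alpha p.1 p.2).prod) =
      ⟨1, τ⟩ ^ c.gen i * ⟨0, t⟩ ^ c.gen j * comm ⟨0, t⟩ ⟨1, τ⟩ ^ c.alpha i j := by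
    rw [map_mul, map_list_prod, map_list_prod, List.map_map, List.map_map]
    congr 1
    · rw [list_prod_map_eq_of_pairwise (List.pairwise_lt_finRange r) hij
        (List.mem_finRange i) (List.mem_finRange j)]
      · simp [hφi, hφj]
      · intro k hki hkj
        simp [hφk k hki hkj]
    · rw [list_prod_map_eq_of_nodup (nodup_pairs r) ((mem_pairs (p := (i, j))).2 hij)]
      · simp [map_comm, hφi, hφj]
      · rintro ⟨k, l⟩ hne hkl
        have hlt : k < l := mem_pairs.1 hkl
        have : φ (inc 3 C k (x k)) = 1 ∨ φ (inc 3 C l (x l)) = 1 := by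
          by_cases hk : k = i
          · subst hk
            exact Or.inr (hφk l hlt.ne' fun h => hne (by rw [h]))
          · by_cases hk' : k = j
            · subst hk'
              exact Or.inr (hφk l (hij.trans hlt).ne' hlt.ne')
            · exact Or.inl (hφk k hk hk')
        rcases this with h | h
        · simp [map_comm, h, comm_one_right]
        · simp [map_comm, h, comm_one_left]
  have hcomm := Subgroup.mem_center_iff.1 hcen
  refine Aff.commute_analysis h1 h2 ht hτ hc ?_ ?_
  · rw [← himg, ← hφi, commute_iff_eq, ← map_mul, ← map_mul, hcomm]
  · rw [← himg, ← hφj, commute_iff_eq, ← map_mul, ← map_mul, hcomm]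

/-- `q (q - 1) = 2 * q.choose 2`, and `q - 1` is odd when `q > 0`. -/
theorem dvd_of_dvd_of_dvd_choose_two {a q : ℕ} (ha : 1 ≤ a) (hq : 2 ^ a ∣ q)
    (hq2 : 2 ^ a ∣ q.choose 2) : 2 ^ (a + 1) ∣ q := by
  rcases Nat.eq_zero_or_pos q with rfl | hpos
  · exact dvd_zero _
  have h2 : 2 ∣ q := (dvd_pow_self 2 (by omega)).trans hq
  have hmul : q * (q - 1) = 2 * q.choose 2 := by
    rw [Nat.choose_two_right, Nat.mul_div_cancel' (Nat.even_mul_pred_self q).two_dvd]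
  have hdvd : 2 ^ (a + 1) ∣ q * (q - 1) := by
    rw [hmul, pow_succ']
    exact mul_dvd_mul_left 2 hq2
  refine Nat.Coprime.dvd_of_dvd_mul_right (Nat.Coprime.pow_left _ ?_) hdvd
  rw [Nat.coprime_two_left, Nat.odd_iff]
  omega

theorem dvd_choose_two_two_pow {a b : ℕ} (hab : a < b) : 2 ^ a ∣ (2 ^ b).choose 2 := by
  obtain ⟨k, rfl⟩ : ∃ k, b = k + 1 := ⟨b - 1, by omega⟩
  rw [pow_succ', choose_two_double Nat.one_le_two_pow]
  have h : 2 ^ a ∣ 2 ^ k := pow_dvd_pow 2 (by omega)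
  exact dvd_add ((h.mul_left 2).mul_right _) h

/-- `1 + N` as a unit, when `N` has cube zero. -/
def unitOneAdd {R : Type*} [CommRing R] (N : R) (hN : N ^ 3 = 0) : Rˣ where
  val := 1 + N
  inv := 1 - N + N ^ 2
  val_inv := by linear_combination hN
  inv_val := by linear_combination hN

include hx hα in
theorem exponents_of_mem_center (hα_pos : ∀ i, 1 ≤ α i) (hα_mono : Monotone α) {i j : Fin r}
    (hij : i < j) {c : Exponents r} (hc : c.InRange α)
    (hcen : c.eval (fun i => inc 3 C i (x i)) ∈ Subgroup.center (NilpotentProduct 3 C)) :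
    c.gen i = 0 ∧ 2 ^ α i ∣ c.alpha i j ∧ 2 ^ (α i + 1) ∣ c.gen j := by
  have hn : 2 ^ α i ≠ 0 := by positivity
  rcases (hα_mono hij.le).lt_or_eq with hlt | heq
  -- For `α i < α j` use characteristic dividing `2 ^ α i` and `τ = 1`; strictness makes `(2 ^ α
  -- j).choose 2` vanish in `R`, so `t` has admissible order.
  · obtain ⟨R, _, N, hN, hf, h1, h2⟩ := exists_testRing (Polynomial.C ((2 ^ α i : ℕ) : ℤ)) hn
      (Polynomial.coeff_C_zero)
    have hf : ((2 ^ α i : ℕ) : R) = 0 := by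
      rw [Polynomial.eval₂_C] at hf
      simpa using hf
    have hz : ∀ k : ℕ, 2 ^ α i ∣ k → (k : R) = 0 := by
      rintro _ ⟨k, rfl⟩
      rw [Nat.cast_mul, hf, zero_mul]
    let t := unitOneAdd N hN
    have ht : (t : R) = 1 + N := rfl
    obtain ⟨hi, hA, hj⟩ := exponents_of_mem_center_aux hx hα hN h1 h2 ht (Or.inl rfl) hij
      (by ext
          · rw [Aff.pow_v]; simpa using hf
          · rw [Aff.pow_t]; simp)
      (by ext
          · rw [Aff.pow_v]; simp
          · rw [Aff.pow_t, Units.val_pow_eq_pow_val, ht, one_add_pow_of_cube_eq_zero hN,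
              hz _ (pow_dvd_pow 2 hlt.le), hz _ (dvd_choose_two_two_pow hlt)]
            simp)
      (hc.1 i) hcen
    refine ⟨hi, hA, ?_⟩
    rw [ht, one_add_pow_of_cube_eq_zero hN] at hj
    have hq := h1 (c.gen j) ((c.gen j).choose 2) (by linear_combination hj)
    refine dvd_of_dvd_of_dvd_choose_two (hα_pos i) hq (h2 _ ?_)
    rw [hz _ hq] at hj
    linear_combination hj
  -- For equal orders that ring would no longer make `t ^ 2 ^ α j` trivial. Imposing instead that
  -- the geometric sum of `1 + N` vanishes, with `τ = t`, kills both `t ^ 2 ^ α i - 1` and the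
  -- translation part of `x_i ^ 2 ^ α i`.
  · obtain ⟨R, _, N, hN, hf, h1, h2⟩ := exists_testRing
      (∑ k ∈ Finset.range (2 ^ α i), (1 + Polynomial.X) ^ k) hn
      (by simp [Polynomial.coeff_zero_eq_eval_zero, Polynomial.eval_finsetSum])
    have hf : ∑ k ∈ Finset.range (2 ^ α i), (1 + N) ^ k = 0 := by
      simpa [Polynomial.eval₂_finsetSum, Polynomial.eval₂_pow] using hf
    let t := unitOneAdd N hN
    have ht : (t : R) = 1 + N := rfl
    have htp : t ^ 2 ^ α i = 1 := by
      ext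
      have := mul_geom_sum (1 + N) (2 ^ α i)
      rw [hf, mul_zero] at this
      rw [Units.val_pow_eq_pow_val, ht, Units.val_one]
      linear_combination -this
    obtain ⟨hi, hA, hj⟩ := exponents_of_mem_center_aux hx hα hN h1 h2 ht (Or.inr rfl) hij
      (by ext
          · rw [Aff.pow_v, ht]; simpa using hf
          · rw [Aff.pow_t, htp]; simp)
      (by ext
          · rw [Aff.pow_v]; simp
          · rw [Aff.pow_t, ← heq, htp]; simp)
      (hc.1 i) hcen
    refine ⟨hi, hA, ?_⟩
    rw [ht, one_add_pow_of_cube_eq_zero hN] at hj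
    have hq := h1 (c.gen j) ((c.gen j).choose 2) (by linear_combination hj)
    -- Here `c.gen j < 2 ^ α j = 2 ^ α i`, so divisibility already forces it to be zero.
    rw [Nat.eq_zero_of_dvd_of_lt hq (heq ▸ hc.1 j)]
    exact dvd_zero _

end Center

end NilpotentProduct

theorem mainTheorem5 (r : ℕ) (hr : 2 ≤ r) (C : Fin r → Type*) [∀ i, Group (C i)]
    (x : ∀ i, C i) (hx : ∀ i, Subgroup.zpowers (x i) = ⊤)
    (α : Fin r → ℕ) (hα : ∀ i, orderOf (x i) = 2 ^ α i)
    (hα_pos : ∀ i, 1 ≤ α i) (hα_mono : Monotone α) :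
    let G := NilpotentProduct 3 C
    let X : Fin r → G := fun i => NilpotentProduct.inc 3 C i (x i)
    let last : Fin r := ⟨r - 1, by omega⟩
    let prev : Fin r := ⟨r - 2, by omega⟩
    (∀ g : G, g ∈ Subgroup.center G ↔
      ∃ c : NilpotentProduct.Exponents r,
        c.InRange α ∧
        g = c.eval X ∧
        (∀ i, i ≠ last → c.gen i = 0) ∧
        c.gen last ≡ 0 [MOD 2 ^ (α prev + 1)] ∧
        ∀ i j, i < j → c.alpha i j ≡ 0 [MOD 2 ^ α i]) ∧
    Subgroup.center G = Subgroup.closure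
      ({X last ^ 2 ^ (α prev + 1)} ∪
        {g | ∃ i j, i < j ∧
          (g = NilpotentProduct.comm (X j) (X i) ^ (2 ^ (α i + 1) - 2) *
              NilpotentProduct.comm (X j) (X i ^ 2) ∨
            g = NilpotentProduct.comm (X j) (X i) ^ (2 ^ (α i + 1) - 2) *
              NilpotentProduct.comm (X j ^ 2) (X i) ∨
            g = NilpotentProduct.comm (X j) (X i) ^ 2 ^ α i)} ∪
        {g | ∃ i j k, i < j ∧ j < k ∧
          (g = NilpotentProduct.comm (NilpotentProduct.comm (X j) (X i)) (X k) ∨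
            g = NilpotentProduct.comm (NilpotentProduct.comm (X k) (X i)) (X j))}) ∧
    Subgroup.center G = Subgroup.closure
      ({X last ^ 2 ^ (α prev + 1)} ∪
        ((⊤ : Subgroup G).lowerCentralSeries 2 : Set G) ∪
        {g | ∃ i j, i < j ∧ g = NilpotentProduct.comm (X j) (X i) ^ 2 ^ α i}) := by
  open NilpotentProduct in
  intro G X last prev
  have hG : (⊤ : Subgroup G).lowerCentralSeries 3 = ⊥ := lowerCentralSeries_three_eq_bot C
  have hgen : Subgroup.closure (Set.range X) = ⊤ := closure_range_inc hx
  have hX : ∀ i, X i ^ 2 ^ α i = 1 := fun i => inc_pow_eq_one hα i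
  set S₁ : Set G := _ with hS₁
  set S₂ : Set G := {X last ^ 2 ^ (α prev + 1)} ∪
        ((⊤ : Subgroup G).lowerCentralSeries 2 : Set G) ∪
        {g | ∃ i j, i < j ∧ g = NilpotentProduct.comm (X j) (X i) ^ 2 ^ α i} with hS₂
  show (∀ g : G, g ∈ Subgroup.center G ↔ _) ∧ Subgroup.center G = Subgroup.closure S₁ ∧
    Subgroup.center G = Subgroup.closure S₂
  have hle_last : ∀ i, i ≠ last → i < last := fun i hi =>
    lt_of_le_of_ne (Fin.le_def.2 (by have := i.2; simp only [last]; omega)) hi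
  have hprev : prev < last := Fin.lt_def.2 (by simp only [prev, last]; omega)
  have hle_prev : ∀ i, i ≠ last → i ≤ prev := fun i hi => by
    have := Fin.lt_def.1 (hle_last i hi)
    exact Fin.le_def.2 (by simp only [prev, last] at this ⊢; omega)
  have h21 : Subgroup.closure S₂ ≤ Subgroup.center G := by
    rw [Subgroup.closure_le]
    rintro g ((rfl | hg) | ⟨i, j, hij, rfl⟩)
    · exact pow_last_mem_center hG hX hgen fun i hi =>
        Nat.succ_le_succ (hα_mono (hle_prev i hi))
    · exact lowerCentralSeries_two_le_center hG hg
    · exact lowerCentralSeries_two_le_center hG (comm_pow_mem_two hG _ (hX i))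
  have hmem2 : ∀ a b d : G, comm (comm a b) d ∈ (⊤ : Subgroup G).lowerCentralSeries 2 :=
    fun a b d => comm_mem_lowerCentralSeries (comm_mem_one a b) d
  have h12 : Subgroup.closure S₁ ≤ Subgroup.closure S₂ := by
    rw [Subgroup.closure_le]
    rintro g ((rfl | ⟨i, j, hij, rfl | rfl | rfl⟩) | ⟨i, j, k, hij, hjk, rfl | rfl⟩)
    · exact Subgroup.subset_closure (Or.inl (Or.inl rfl))
    · rw [pow_succ', comm_pow_mul_comm_sq_right hG _ Nat.one_le_two_pow (hX i)]
      exact Subgroup.subset_closure (Or.inl (Or.inr (hmem2 _ _ _)))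
    · rw [pow_succ', comm_pow_mul_comm_sq_left hG _ Nat.one_le_two_pow (hX i)]
      exact Subgroup.subset_closure (Or.inl (Or.inr (hmem2 _ _ _)))
    · exact Subgroup.subset_closure (Or.inr ⟨i, j, hij, rfl⟩)
    · exact Subgroup.subset_closure (Or.inl (Or.inr (hmem2 _ _ _)))
    · exact Subgroup.subset_closure (Or.inl (Or.inr (hmem2 _ _ _)))
  have hform : ∀ c : Exponents r, (∀ i, i ≠ last → c.gen i = 0) →
      c.gen last ≡ 0 [MOD 2 ^ (α prev + 1)] →
      (∀ i j, i < j → c.alpha i j ≡ 0 [MOD 2 ^ α i]) → c.eval X ∈ Subgroup.closure S₁ := by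
    intro c hc hl hal
    refine eval_mem hG (K := Subgroup.closure S₁)
      (Subgroup.subset_closure (Or.inl (Or.inl rfl))) ?_ ?_ ?_ ?_ ?_ hc
      ((Nat.modEq_zero_iff_dvd).1 hl) fun i j hij => (Nat.modEq_zero_iff_dvd).1 (hal i j hij)
    · exact fun i j hij => Subgroup.subset_closure
        (Or.inl (Or.inr ⟨i, j, hij, Or.inr (Or.inr rfl)⟩))
    · intro i j hij
      rw [← comm_pow_mul_comm_sq_right hG _ Nat.one_le_two_pow (hX i), ← pow_succ']
      exact Subgroup.subset_closure (Or.inl (Or.inr ⟨i, j, hij, Or.inl rfl⟩))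
    · intro i j hij
      rw [← comm_pow_mul_comm_sq_left hG _ Nat.one_le_two_pow (hX i), ← pow_succ']
      exact Subgroup.subset_closure (Or.inl (Or.inr ⟨i, j, hij, Or.inr (Or.inl rfl)⟩))
    · exact fun i j k hij hjk => Subgroup.subset_closure
        (Or.inr ⟨i, j, k, hij, hjk, Or.inl rfl⟩)
    · exact fun i j k hij hjk => Subgroup.subset_closure
        (Or.inr ⟨i, j, k, hij, hjk, Or.inr rfl⟩)
  have hcen : ∀ g ∈ Subgroup.center G, ∃ c : Exponents r, c.InRange α ∧ g = c.eval X ∧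
      (∀ i, i ≠ last → c.gen i = 0) ∧ c.gen last ≡ 0 [MOD 2 ^ (α prev + 1)] ∧
      ∀ i j, i < j → c.alpha i j ≡ 0 [MOD 2 ^ α i] := by
    intro g hg
    obtain ⟨c, hc, rfl⟩ := exists_eval hG hX hα_pos hgen g
    have key : ∀ i j, i < j → _ := fun i j hij =>
      exponents_of_mem_center hx hα hα_pos hα_mono hij hc hg
    -- Pairing `i` with `last` kills `c.gen i`; since `α` is monotone, the pair `prev`, `last` gives
    -- the strongest condition on `c.gen last`.
    exact ⟨c, hc, rfl, fun i hi => (key i last (hle_last i hi)).1,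
      (Nat.modEq_zero_iff_dvd).2 (key prev last hprev).2.2,
      fun i j hij => (Nat.modEq_zero_iff_dvd).2 (key i j hij).2.1⟩
  have h01 : Subgroup.center G ≤ Subgroup.closure S₁ := fun g hg => by
    obtain ⟨c, -, rfl, h⟩ := hcen g hg
    exact hform c h.1 h.2.1 h.2.2
  -- The inclusions form a cycle: centre, subgroup of (b), subgroup of (c), centre.
  refine ⟨fun g => ⟨hcen g, ?_⟩, le_antisymm h01 (h12.trans h21),
    le_antisymm (h01.trans h12) h21⟩
  rintro ⟨c, -, rfl, h⟩
  exact h21 (h12 (hform c h.1 h.2.1 h.2.2))
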